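/- **Setting.** An *ultragraph* $\mathcal G=(G^0,\mathcal G^1,r,s)$ consists of countable sets $G^0,\mathcal G^1$ and maps $s:\mathcal G^1\to G^0$, $r:\mathcal G^1\to P(G^0)\setminus\{\emptyset\}$. Let $\mathcal G^0$ be the smallest family of subsets of $G^0$ containing all $\{v\}$ and all $r(e)$ and closed under finite unions (so $\emptyset\in\mathcal G^0$) and intersections of nonempty finite subfamilies. $C^*(\mathcal G)$ is the universal C*-algebra generated by partial isometries $s_e$ $(e\in\mathcal G^1)$ with mutually orthogonal ranges and projections $p_A$ $(A\in\mathcal G^0)$ such that $p_\emptyset=0$, $p_Ap_B=p_{A\cap B}$, $p_{A\cup B}=p_A+p_B-p_{A\cap B}$; $s_e^*s_e=p_{r(e)}$; $s_es_e^*\le p_{s(e)}$; and $p_v=\sum_{s(e)=v}s_es_e^*$ whenever $0<|s^{-1}(v)|<\infty$. Let $(X,\mu)$ be a $\sigma$-finite measure space. A *$\mathcal G$-branching system* on $(X,\mu)$ consists of measurable sets $R_e,D_A\subseteq X$ $(e\in\mathcal G^1,A\in\mathcal G^0)$ such that, up to $\mu$-null sets, $R_e\cap R_{e'}=\emptyset$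 for $e\ne e'$; $D_A\cap D_B=D_{A\cap B}$, $D_A\cup D_B=D_{A\cup B}$ (and $D_\emptyset=\emptyset$); $R_e\subseteq D_{s(e)}$; $D_v=\bigcup_{s(e)=v}R_e$ if $0<|s^{-1}(v)|<\infty$; together with measurable maps $f_e:D_{r(e)}\to R_e$ and $f_e^{-1}:R_e\to D_{r(e)}$ that are inverse to each other $\mu$-a.e. and such that the pushforward $\mu\circ f_e$ of $\mu|_{R_e}$ under $f_e^{-1}$ and the pushforward $\mu\circ f_e^{-1}$ of $\mu|_{D_{r(e)}}$ under $f_e$ are absolutely continuous with respect to $\mu|_{D_{r(e)}}$ and $\mu|_{R_e}$, respectively. Put $\Phi_{f_e^{-1}}=d(\mu\circ f_e^{-1})/d\mu$ on $R_e$. $L^p$ spaces are complex. **Theorem.** Let $\mathcal G$ be an ultragraph with a $\mathcal G$-branching system on a $\sigma$-finite measure space $(X,\mu)$, and let $F:X\to X$ be a nonsingular map (measurable, with $\mu(F^{-1}(S))=0$ for every measurable $S$ with $\mu(S)=0$) such that $F|_{R_e}=f_e^{-1}$ $\mu$-a.e. for all $e\in\mathcal G^1$. There are a unique $*$-homomorphism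 $\pi:C^*(\mathcal G)\to B(L^2(X,\mu))$ with $\pi(s_e)\phi=\Phi_{f_e^{-1}}^{1/2}\cdot(\phi\circ f_e^{-1})$ (extended by $0$ outside $R_e$) and $\pi(p_A)\phi=\chi_{D_A}\phi$ for all $e\in\mathcal G^1$, $A\in\mathcal G^0$, $\phi\in L^2(X,\mu)$, and a unique bounded operator $P_F$ on $L^1(X,\mu)$ (the Perron–Frobenius operator of $F$) with $\int_SP_F\phi\,d\mu=\int_{F^{-1}(S)}\phi\,d\mu$ for all $\phi\in L^1(X,\mu)$ and all measurable $S\subseteq X$. For these, and for $\phi\in L^2(X,\mu)$, $\eta\in L^1(X,\mu)$: 1. If $e_1,\dots,e_n$ are distinct edges and $\operatorname{supp}\phi\subseteq\bigcup_{i=1}^nR_{e_i}$ $\mu$-a.e., then $P_F(\phi^2)=\sum_{i=1}^n(\pi(s_{e_i}^*)\phi)^2$ $\mu$-a.e. 2. If $e_1,e_2,\dots$ are distinct edges and $\operatorname{supp}\phi\subseteq\bigcup_{i=1}^\infty R_{e_i}$ $\mu$-a.e., then $P_F(\phi^2)=\lim_{n\to\infty}\sum_{i=1}^n(\pi(s_{e_i}^*)\phi)^2$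 in $L^1(X,\mu)$. 3. If $e_1,e_2,\dots$ are distinct edges and $\eta=\eta_1-\eta_2+i(\eta_3-\eta_4)$, where each $\eta_k\in L^1(X,\mu)$ is nonnegative $\mu$-a.e. with $\operatorname{supp}\eta_k\subseteq\bigcup_{i=1}^\infty R_{e_i}$ $\mu$-a.e., then in $L^1(X,\mu)$ $$P_F(\eta)=\lim_{n\to\infty}\sum_{i=1}^n\Big((\pi(s_{e_i}^*)\sqrt{\eta_1})^2-(\pi(s_{e_i}^*)\sqrt{\eta_2})^2+i(\pi(s_{e_i}^*)\sqrt{\eta_3})^2-i(\pi(s_{e_i}^*)\sqrt{\eta_4})^2\Big).$$ If instead finitely many distinct edges $e_1,\dots,e_n$ are given and $\operatorname{supp}\eta_k\subseteq\bigcup_{i=1}^nR_{e_i}$ $\mu$-a.e. for each $k$, then the same formula holds with the finite sum in place of the limit. -/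

import Mathlib

open MeasureTheory Filter Topology
open scoped ENNReal

universe v e w u

/-- An ultragraph with vertex set `V` and edge set `E`: both sets are countable, `s e` is the source
vertex of the edge `e`, and `r e` is its range, a nonempty set of vertices. -/
structure Ultragraph (V : Type*) (E : Type*) where
  countable_vertices : Countable V
  countable_edges : Countable E
  s : E → V
  r : E → Set V
  r_nonempty : ∀ e, (r e).Nonempty

namespace Ultragraph

section Algebra

variable {V : Type v} {E : Type e} (G : Ultragraph V E)

/-- Membership in the smallest family of subsets of `V` that contains all singletons and all
ranges of edges and is closed under finite unions (including the empty one) and under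
intersections of nonempty finite families. -/
inductive IsGeneralizedVertex : Set V → Prop
  | empty : IsGeneralizedVertex ∅
  | singleton (v : V) : IsGeneralizedVertex {v}
  | range (e : E) : IsGeneralizedVertex (G.r e)
  | union {A B : Set V} : IsGeneralizedVertex A → IsGeneralizedVertex B →
      IsGeneralizedVertex (A ∪ B)
  | inter {A B : Set V} : IsGeneralizedVertex A → IsGeneralizedVertex B →
      IsGeneralizedVertex (A ∩ B)

/-- The set of generalized vertices of `G`. -/
def GVertex : Type _ := {A : Set V // G.IsGeneralizedVertex A}

namespace GVertex

variable {G}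

instance : EmptyCollection G.GVertex := ⟨⟨∅, .empty⟩⟩
instance : Union G.GVertex := ⟨fun A B => ⟨A.1 ∪ B.1, A.2.union B.2⟩⟩
instance : Inter G.GVertex := ⟨fun A B => ⟨A.1 ∩ B.1, A.2.inter B.2⟩⟩

variable (G) in
/-- The generalized vertex `{v}`. -/
def vertex (v : V) : G.GVertex := ⟨{v}, .singleton v⟩

variable (G) in
/-- The generalized vertex `r e`. -/
def edgeRange (e : E) : G.GVertex := ⟨G.r e, .range e⟩

end GVertex

/-- A Cuntz-Krieger `G`-family in a C*-algebra `A`: partial isometries `S e` with mutually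
orthogonal ranges and projections `P B` satisfying the Cuntz-Krieger relations. -/
structure CKFamily (A : Type*) [NonUnitalCStarAlgebra A] where
  S : E → A
  P : G.GVertex → A
  isPartialIsometry : ∀ e, S e * star (S e) * S e = S e
  orthogonal_ranges : ∀ e f, e ≠ f → (S e * star (S e)) * (S f * star (S f)) = 0
  isProjection : ∀ B, IsStarProjection (P B)
  P_empty : P ∅ = 0
  P_inter : ∀ B C, P B * P C = P (B ∩ C)
  P_union : ∀ B C, P (B ∪ C) = P B + P C - P (B ∩ C)
  star_S_mul_S : ∀ e, star (S e) * S e = P (GVertex.edgeRange G e)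
  /-- The projection `S e * star (S e)` is a subprojection of `P {s e}` (for projections, `q ≤ p`
  means `p * q = q`). -/
  range_le : ∀ e, P (GVertex.vertex G (G.s e)) * (S e * star (S e)) = S e * star (S e)
  /-- If `v` emits at least one and only finitely many edges, and `T` is the finite set of edges
  with source `v`, then `P {v}` is the sum of the range projections of these edges. -/
  P_vertex : ∀ (v : V) (T : Finset E), (∀ e, e ∈ T ↔ G.s e = v) → T.Nonempty →
    P (GVertex.vertex G v) = ∑ e ∈ T, S e * star (S e)

theorem norm_le_one_of_isStarProjection {A : Type*} [NonUnitalCStarAlgebra A] {p : A}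
    (hp : IsStarProjection p) : ‖p‖ ≤ 1 := by
  have h := CStarRing.norm_star_mul_self (x := p)
  rw [hp.isSelfAdjoint.star_eq, hp.isIdempotentElem.eq] at h
  nlinarith [norm_nonneg p]

namespace CKFamily

variable {G} {A : Type*} [NonUnitalCStarAlgebra A] (K : G.CKFamily A)

theorem norm_P_le (B : G.GVertex) : ‖K.P B‖ ≤ 1 :=
  norm_le_one_of_isStarProjection (K.isProjection B)

theorem norm_S_le (e : E) : ‖K.S e‖ ≤ 1 := by
  have h := CStarRing.norm_star_mul_self (x := K.S e)
  rw [K.star_S_mul_S e] at h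
  nlinarith [norm_nonneg (K.S e), K.norm_P_le (GVertex.edgeRange G e)]

end CKFamily

/-- A C*-algebra together with a Cuntz-Krieger `G`-family in it. -/
structure CKPair where
  A : Type w
  [inst : NonUnitalCStarAlgebra A]
  K : G.CKFamily A

attribute [instance] CKPair.inst

/-- The C*-algebra of bounded families indexed by all Cuntz-Krieger `G`-families. -/
abbrev CKProduct : Type _ := lp (fun i : CKPair.{v, e, w} G => i.A) ∞

/-- The element of the product whose coordinate at a Cuntz-Krieger family is its `S e`. -/
def productS (e : E) : CKProduct.{v, e, w} G :=
  ⟨fun i => i.K.S e, memℓp_infty ⟨1, by rintro _ ⟨i, rfl⟩; exact i.K.norm_S_le e⟩⟩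

/-- The element of the product whose coordinate at a Cuntz-Krieger family is its `P B`. -/
def productP (B : G.GVertex) : CKProduct.{v, e, w} G :=
  ⟨fun i => i.K.P B, memℓp_infty ⟨1, by rintro _ ⟨i, rfl⟩; exact i.K.norm_P_le B⟩⟩

/-- The C*-subalgebra of the product that is generated by the elements `productS e`,
`productP B`. -/
noncomputable def universalSubalgebra : NonUnitalStarSubalgebra ℂ (CKProduct.{v, e, w} G) :=
  (NonUnitalStarAlgebra.adjoin ℂ
    (Set.range (productS.{v, e, w} G) ∪ Set.range (productP.{v, e, w} G))).topologicalClosure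

instance isClosed_universalSubalgebra :
    IsClosed (universalSubalgebra.{v, e, w} G : Set (CKProduct.{v, e, w} G)) :=
  NonUnitalStarSubalgebra.isClosed_topologicalClosure _

/-- The ultragraph C*-algebra `C*(G)`, i.e. the universal C*-algebra generated by a Cuntz-Krieger
`G`-family, realised as the C*-algebra generated by the product of all such families. As `V` and `E`
are countable, every C*-algebra generated by a Cuntz-Krieger `G`-family is separable, hence has an
isomorphic copy in every universe; so the universe `w` does not matter up to isomorphism. -/
abbrev CStarAlg : Type _ := universalSubalgebra.{v, e, w} G

/-- The canonical partial isometry `s_e` in `C*(G)`. -/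
noncomputable def genS (e : E) : CStarAlg.{v, e, w} G :=
  ⟨productS.{v, e, w} G e, NonUnitalStarSubalgebra.le_topologicalClosure _
    (NonUnitalStarAlgebra.subset_adjoin ℂ _ (Or.inl (Set.mem_range_self _)))⟩

/-- The canonical projection `p_B` in `C*(G)`. -/
noncomputable def genP (B : G.GVertex) : CStarAlg.{v, e, w} G :=
  ⟨productP.{v, e, w} G B, NonUnitalStarSubalgebra.le_topologicalClosure _
    (NonUnitalStarAlgebra.subset_adjoin ℂ _ (Or.inr (Set.mem_range_self _)))⟩

/-- The canonical generators form a Cuntz-Krieger `G`-family in `C*(G)`. -/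
noncomputable def universalFamily : G.CKFamily (CStarAlg.{v, e, w} G) where
  S := genS.{v, e, w} G
  P := genP.{v, e, w} G
  isPartialIsometry e := Subtype.ext <| Subtype.ext <| funext fun i => i.K.isPartialIsometry e
  orthogonal_ranges e f h := Subtype.ext <| Subtype.ext <| funext fun i => i.K.orthogonal_ranges e f h
  isProjection B := ⟨Subtype.ext <| Subtype.ext <| funext fun i => (i.K.isProjection B).1,
    Subtype.ext <| Subtype.ext <| funext fun i => (i.K.isProjection B).2⟩
  P_empty := Subtype.ext <| Subtype.ext <| funext fun i => i.K.P_empty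
  P_inter B C := Subtype.ext <| Subtype.ext <| funext fun i => i.K.P_inter B C
  P_union B C := Subtype.ext <| Subtype.ext <| funext fun i => i.K.P_union B C
  star_S_mul_S e := Subtype.ext <| Subtype.ext <| funext fun i => i.K.star_S_mul_S e
  range_le e := Subtype.ext <| Subtype.ext <| funext fun i => i.K.range_le e
  P_vertex := by
    intro v T hT hne
    let ev (i : CKPair.{v, e, w} G) : CStarAlg.{v, e, w} G →+ i.A :=
      { toFun := fun x => x.1.1 i, map_zero' := rfl, map_add' := fun _ _ => rfl }
    refine Subtype.ext <| Subtype.ext <| funext fun i => ?_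
    exact (i.K.P_vertex v T hT hne).trans
      (map_sum (ev i) (fun e => genS.{v, e, w} G e * star (genS.{v, e, w} G e)) T).symm

/-- The universal property of `C*(G)`. -/
theorem existsUnique_lift {A : Type w} [NonUnitalCStarAlgebra A] (K : G.CKFamily A) :
    ∃! π : CStarAlg.{v, e, w} G →⋆ₙₐ[ℂ] A,
      (∀ e, π (genS.{v, e, w} G e) = K.S e) ∧ ∀ B, π (genP.{v, e, w} G B) = K.P B := by
  let i : CKPair.{v, e, w} G := ⟨A, K⟩
  let ev : CStarAlg.{v, e, w} G →⋆ₙₐ[ℂ] A :=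
    { toFun := fun x => x.1.1 i, map_zero' := rfl, map_add' := fun _ _ => rfl, map_smul' := fun _ _ => rfl
      map_mul' := fun _ _ => rfl, map_star' := fun _ => rfl }
  refine ⟨ev, ⟨fun _ => rfl, fun _ => rfl⟩, ?_⟩
  rintro ρ ⟨h1, h2⟩
  have hc : Continuous ρ := (AddMonoidHomClass.continuous_of_bound ρ 1 fun x => by simpa using NonUnitalStarAlgHom.norm_apply_le ρ x)
  have hc' : Continuous ev := (AddMonoidHomClass.continuous_of_bound ev 1 fun x => by simpa using NonUnitalStarAlgHom.norm_apply_le ev x)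
  ext ⟨x, hx⟩
  have key : ∀ y (hy : y ∈ NonUnitalStarAlgebra.adjoin ℂ
    (Set.range (productS.{v, e, w} G) ∪ Set.range (productP.{v, e, w} G))),
      ρ ⟨y, NonUnitalStarSubalgebra.le_topologicalClosure _ hy⟩ = ev ⟨y, NonUnitalStarSubalgebra.le_topologicalClosure _ hy⟩ := by
    intro y hy
    induction hy using NonUnitalStarAlgebra.adjoin_induction with
    | mem x h =>
      rcases h with ⟨e, rfl⟩ | ⟨B, rfl⟩
      · exact h1 e
      · exact h2 B
    | add x y hx hy a b =>
      have := congrArg₂ (· + ·) a b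
      exact (map_add ρ _ _).trans (this.trans (map_add ev _ _).symm)
    | zero => exact (map_zero ρ).trans (map_zero ev).symm
    | mul x y hx hy a b =>
      have := congrArg₂ (· * ·) a b
      exact (map_mul ρ _ _).trans (this.trans (map_mul ev _ _).symm)
    | smul r x hx a =>
      have := congrArg (r • ·) a
      exact (map_smul ρ r _).trans (this.trans (map_smul ev r _).symm)
    | star x hx a =>
      have := congrArg star a
      exact (map_star ρ _).trans (this.trans (map_star ev _).symm)
  have hcl : IsClosed {z : CStarAlg.{v, e, w} G | ρ z = ev z} := isClosed_eq hc hc'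
  have hd : (⟨x,hx⟩ : CStarAlg.{v, e, w} G) ∈ closure {z : CStarAlg.{v, e, w} G | z.1 ∈ (NonUnitalStarAlgebra.adjoin ℂ
    (Set.range (productS.{v, e, w} G) ∪ Set.range (productP.{v, e, w} G)))} := by
    have : (x : CKProduct G) ∈ closure ((NonUnitalStarAlgebra.adjoin ℂ
      (Set.range (productS.{v, e, w} G) ∪ Set.range (productP.{v, e, w} G)) : NonUnitalStarSubalgebra ℂ _) : Set _) := hx
    change (⟨x,hx⟩ : universalSubalgebra G) ∈ closure (Subtype.val ⁻¹' _)
    rw [closure_subtype]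
    refine closure_mono ?_ this
    intro y hy
    exact ⟨⟨y, NonUnitalStarSubalgebra.le_topologicalClosure _ hy⟩, hy, rfl⟩
  exact closure_minimal (fun z hz => key z.1 hz) hcl hd

end Algebra

section BranchingSystem

variable {V : Type v} {E : Type e} {X : Type u} [MeasurableSpace X]

/-- The restriction of `μ` to the subset `S`, as a measure on the subtype. -/
noncomputable abbrev onSubset (μ : Measure X) (S : Set X) : Measure S :=
  μ.comap (Subtype.val : S → X)

/-- A `G`-branching system on the measure space `(X, μ)`. -/
structure BranchingSystem (G : Ultragraph V E) (μ : Measure X) where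
  R : E → Set X
  D : G.GVertex → Set X
  measurableSet_R : ∀ e, MeasurableSet (R e)
  measurableSet_D : ∀ A, MeasurableSet (D A)
  R_disjoint : ∀ e e', e ≠ e' → (R e ∩ R e' : Set X) =ᵐ[μ] (∅ : Set X)
  D_empty : D ∅ = ∅
  D_inter : ∀ A B, (D A ∩ D B : Set X) =ᵐ[μ] D (A ∩ B)
  D_union : ∀ A B, (D A ∪ D B : Set X) =ᵐ[μ] D (A ∪ B)
  R_subset : ∀ e, R e ≤ᵐ[μ] D (GVertex.vertex G (G.s e))
  D_vertex : ∀ v, {e | G.s e = v}.Nonempty → {e | G.s e = v}.Finite →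
    D (GVertex.vertex G v) =ᵐ[μ] (⋃ e ∈ {e | G.s e = v}, R e : Set X)
  f : ∀ e, D (GVertex.edgeRange G e) → R e
  finv : ∀ e, R e → D (GVertex.edgeRange G e)
  measurable_f : ∀ e, Measurable (f e)
  measurable_finv : ∀ e, Measurable (finv e)
  f_finv : ∀ e, ∀ᵐ x ∂(onSubset μ (R e)), f e (finv e x) = x
  finv_f : ∀ e, ∀ᵐ x ∂(onSubset μ (D (GVertex.edgeRange G e))), finv e (f e x) = x
  /-- The pushforward under `finv e` (denoted `μ ∘ f e`) is absolutely continuous. -/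
  map_finv_ac : ∀ e, (onSubset μ (R e)).map (finv e) ≪ onSubset μ (D (GVertex.edgeRange G e))
  /-- The pushforward under `f e` (denoted `μ ∘ (f e)⁻¹`) is absolutely continuous. -/
  map_f_ac : ∀ e, (onSubset μ (D (GVertex.edgeRange G e))).map (f e) ≪ onSubset μ (R e)

namespace BranchingSystem

variable {G : Ultragraph V E} {μ : Measure X} (B : G.BranchingSystem μ)

/-- The Radon-Nikodym derivative `d(μ ∘ (f e)⁻¹)/dμ` on `R e`. -/
noncomputable def Phi_finv (e : E) : B.R e → ℝ≥0∞ :=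
  ((onSubset μ (B.D (GVertex.edgeRange G e))).map (B.f e)).rnDeriv (onSubset μ (B.R e))

open Classical in
/-- The function `Φ^{1/2} · (φ ∘ (f e)⁻¹)`, where `Φ = d(μ ∘ (f e)⁻¹)/dμ`, extended by zero outside
`R e`. -/
noncomputable def weightedComp (e : E) (φ : X → ℂ) (x : X) : ℂ :=
  if h : x ∈ B.R e then
    (Real.sqrt (B.Phi_finv e ⟨x, h⟩).toReal : ℂ) * φ (B.finv e ⟨x, h⟩)
  else 0

/-- `π` is the representation of `C*(G)` on `L²(X, μ)` induced by the branching system: a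
*-homomorphism with the prescribed values on the canonical generators. -/
def IsInducedRep (π : CStarAlg.{v, e, w} G →⋆ₙₐ[ℂ] (Lp ℂ 2 μ →L[ℂ] Lp ℂ 2 μ)) : Prop :=
  (∀ (e : E) (φ : Lp ℂ 2 μ), π (genS.{v, e, w} G e) φ =ᵐ[μ] B.weightedComp e φ) ∧
  ∀ (A : G.GVertex) (φ : Lp ℂ 2 μ), π (genP.{v, e, w} G A) φ =ᵐ[μ] (B.D A).indicator φ

/-- The map `F : X → X` satisfies `F = (f e)⁻¹` almost everywhere on each `R e`. -/
def AgreesWith (F : X → X) : Prop :=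
  ∀ e, ∀ᵐ x : B.R e ∂(onSubset μ (B.R e)), F (x : X) = (B.finv e x : X)

end BranchingSystem

end BranchingSystem

end Ultragraph

section PerronFrobenius

variable {X : Type*} [MeasurableSpace X]

/-- `P` is the Perron-Frobenius operator of `F` on the complex space `L¹(X, μ)`. -/
def IsPerronFrobenius {μ : Measure X} (F : X → X) (P : Lp ℂ 1 μ →L[ℂ] Lp ℂ 1 μ) : Prop :=
  ∀ (φ : Lp ℂ 1 μ) (S : Set X), MeasurableSet S →
    ∫ x in S, P φ x ∂μ = ∫ x in F ⁻¹' S, φ x ∂μ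

theorem memLp_sq {μ : Measure X} (φ : Lp ℂ 2 μ) : MemLp (fun x => φ x ^ 2) 1 μ := by
  have h : MemLp (fun x => φ x * φ x) 1 μ := (Lp.memLp φ).mul' (Lp.memLp φ)
  simpa only [pow_two] using h

/-- The pointwise square `φ²` in `L¹(X, μ)` of `φ` in `L²(X, μ)`. -/
noncomputable def sqL1 {μ : Measure X} (φ : Lp ℂ 2 μ) : Lp ℂ 1 μ := (memLp_sq φ).toLp _

theorem memLp_sqrt {μ : Measure X} (η : Lp ℝ 1 μ) :
    MemLp (fun x => (Real.sqrt (η x) : ℂ)) 2 μ := by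
  have hm : AEStronglyMeasurable (fun x => (Real.sqrt (η x) : ℂ)) μ :=
    Complex.continuous_ofReal.comp_aestronglyMeasurable
      (Real.continuous_sqrt.comp_aestronglyMeasurable (Lp.aestronglyMeasurable η))
  rw [← integrable_norm_rpow_iff hm (by norm_num) (by norm_num)]
  have hi : Integrable (fun x => η x) μ := memLp_one_iff_integrable.1 (Lp.memLp η)
  refine hi.mono (hm.norm.aemeasurable.pow_const _).aestronglyMeasurable (ae_of_all _ fun x => ?_)
  simp only [ENNReal.toReal_ofNat, Real.rpow_two, Complex.norm_real, norm_pow, norm_norm]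
  rw [Real.norm_eq_abs, sq_abs]
  rcases le_total 0 (η x) with h | h
  · rw [Real.sq_sqrt h]; exact Real.le_norm_self _
  · rw [Real.sqrt_eq_zero_of_nonpos h]; simp

/-- The pointwise square root in (complex) `L²(X, μ)` of a nonnegative `η` in `L¹(X, μ)`. -/
noncomputable def sqrtL2 {μ : Measure X} (η : Lp ℝ 1 μ) : Lp ℂ 2 μ := (memLp_sqrt η).toLp _

end PerronFrobenius

/-! For an edge `e` let `σ` and `w` be the extensions to `X` of `f_e⁻¹` and of its density `Φ`, and
write `D` for `D_{r(e)}`. By the definition of `Φ`, `σ` carries `w μ` to `μ` restricted to `D`.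
Hence `T φ = w^{1/2} (φ ∘ σ)` satisfies `‖T φ‖ = ‖1_D φ‖` and `T* T = 1_D`. As `Φ > 0` a.e. on `R_e`
and `f_e` inverts `σ` there, the range of `T` is `L²(R_e)`, so `T T* = 1_{R_e}`. The Cuntz-Krieger
relations thus become a.e. identities between sets, and the universal property yields `π`. The
operator `P_F` comes from Radon-Nikodym: nonsingularity of `F` makes the pushforward of `φ μ`
absolutely continuous.

The link between the two is `IsWeightedSubstitution.sqL1_star_toCLM`. With `ψ = T* φ` one has
`1_{R_e} φ = T ψ`, and `(T ψ)² = w (ψ² ∘ σ)`. Since `F = σ` a.e. on `R_e`, a change of variables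
gives `P_F ((1_{R_e} φ)²) = (T* φ)²`.

The sets `R_e` are almost disjoint, so `φ²` is the sum of the `(1_{R_e} φ)²`, in the infinite case
as an `L¹` limit by dominated convergence. Linearity and continuity of `P_F` give the first two
formulas; the others follow by writing each `η_k` as `(√η_k)²`. -/

/-! ### Existence and uniqueness of the Perron-Frobenius operator. -/

section PerronFrobeniusOperator

variable {X : Type*} [MeasurableSpace X] {μ : Measure X}

/-- Integrable functions with the same integral over every measurable set agree in `L¹`. -/
theorem Lp_one_ext_setIntegral {f g : Lp ℂ 1 μ}
    (h : ∀ S, MeasurableSet S → ∫ x in S, f x ∂μ = ∫ x in S, g x ∂μ) : f = g :=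
  Lp.ext <| Integrable.ae_eq_of_forall_setIntegral_eq _ _ (L1.integrable_coeFn f)
    (L1.integrable_coeFn g) fun S hS _ => h S hS

/-- The function `g` is the Radon-Nikodym derivative of the pushforward under `F` of the signed
measure `φ μ`; nonsingularity of `F` makes this pushforward absolutely continuous. -/
theorem exists_integrable_setIntegral_preimage_real [SigmaFinite μ] {F : X → X}
    (hF : Measure.QuasiMeasurePreserving F μ μ) {φ : X → ℝ} (hφ : Integrable φ μ) :
    ∃ g : X → ℝ, Integrable g μ ∧
      ∀ S, MeasurableSet S → ∫ x in S, g x ∂μ = ∫ x in F ⁻¹' S, φ x ∂μ := by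
  have hval : ∀ S, MeasurableSet S →
      (μ.withDensityᵥ φ).map F S = ∫ x in F ⁻¹' S, φ x ∂μ := fun S hS => by
    rw [VectorMeasure.map_apply _ hF.measurable hS, withDensityᵥ_apply hφ (hF.measurable hS)]
  have hac : ((μ.withDensityᵥ φ).map F) ≪ᵥ μ.toENNRealVectorMeasure := by
    refine VectorMeasure.AbsolutelyContinuous.mk fun S hS h0 => ?_
    rw [Measure.toENNRealVectorMeasure_apply_measurable hS] at h0
    rw [hval S hS, Measure.restrict_eq_zero.2 (hF.preimage_null h0), integral_zero_measure]
  refine ⟨SignedMeasure.rnDeriv ((μ.withDensityᵥ φ).map F) μ,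
    SignedMeasure.integrable_rnDeriv _ _, fun S hS => ?_⟩
  rw [← hval S hS, ← withDensityᵥ_apply (SignedMeasure.integrable_rnDeriv _ _) hS,
    SignedMeasure.withDensityᵥ_rnDeriv_eq _ μ hac]

theorem exists_Lp_setIntegral_preimage [SigmaFinite μ] {F : X → X}
    (hF : Measure.QuasiMeasurePreserving F μ μ) (φ : Lp ℂ 1 μ) :
    ∃ g : Lp ℂ 1 μ, ∀ S, MeasurableSet S → ∫ x in S, g x ∂μ = ∫ x in F ⁻¹' S, φ x ∂μ := by
  have hφ := L1.integrable_coeFn φ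
  obtain ⟨g, hg, hgS⟩ := exists_integrable_setIntegral_preimage_real hF hφ.re
  obtain ⟨h, hh, hhS⟩ := exists_integrable_setIntegral_preimage_real hF hφ.im
  have hi : Integrable (fun x => (g x : ℂ) + h x * Complex.I) μ :=
    hg.ofReal.add (hh.ofReal.mul_const _)
  refine ⟨hi.toL1 _, fun S hS => ?_⟩
  have h1 : Integrable (fun x => (g x : ℂ)) (μ.restrict S) := hg.ofReal.integrableOn
  have h2 : Integrable (fun x => h x * Complex.I) (μ.restrict S) :=
    (hh.ofReal.mul_const _).integrableOn
  rw [integral_congr_ae (ae_restrict_of_ae hi.coeFn_toL1), integral_add h1 h2,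
    integral_mul_const, integral_complex_ofReal, integral_complex_ofReal, hgS S hS, hhS S hS]
  exact integral_re_add_im hφ.integrableOn

theorem existsUnique_isPerronFrobenius [SigmaFinite μ] {F : X → X}
    (hF : Measure.QuasiMeasurePreserving F μ μ) :
    ∃! P : Lp ℂ 1 μ →L[ℂ] Lp ℂ 1 μ, IsPerronFrobenius F P := by
  choose T hT using exists_Lp_setIntegral_preimage hF
  let L : Lp ℂ 1 μ →ₗ[ℂ] Lp ℂ 1 μ :=
    { toFun := T
      map_add' := fun φ ψ => Lp_one_ext_setIntegral fun S hS => by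
        rw [hT _ S hS, integral_congr_ae (ae_restrict_of_ae (Lp.coeFn_add φ ψ)),
          integral_congr_ae (ae_restrict_of_ae (Lp.coeFn_add (T φ) (T ψ)))]
        simp only [Pi.add_apply]
        rw [integral_add (L1.integrable_coeFn _).integrableOn (L1.integrable_coeFn _).integrableOn,
          integral_add (L1.integrable_coeFn _).integrableOn (L1.integrable_coeFn _).integrableOn,
          hT _ S hS, hT _ S hS]
      map_smul' := fun c φ => Lp_one_ext_setIntegral fun S hS => by
        rw [hT _ S hS, integral_congr_ae (ae_restrict_of_ae (Lp.coeFn_smul c φ)), RingHom.id_apply,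
          integral_congr_ae (ae_restrict_of_ae (Lp.coeFn_smul c (T φ)))]
        simp only [Pi.smul_apply]
        rw [integral_smul, integral_smul, hT _ S hS] }
  -- Boundedness by the closed graph theorem: integration over a fixed set is continuous on `L¹`, so
  -- the defining identity passes to limits and identifies the limit.
  have hL : Continuous L := L.continuous_of_seq_closed_graph fun φ x y hx hy =>
    Lp_one_ext_setIntegral fun S hS => by
      have h1 := ((continuous_setIntegral S).tendsto y).comp hy
      have h2 := ((continuous_setIntegral (F ⁻¹' S)).tendsto x).comp hx
      refine (tendsto_nhds_unique h1 (h2.congr fun n => (hT (φ n) S hS).symm)).trans ?_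
      exact (hT x S hS).symm
  refine ⟨⟨L, hL⟩, hT, fun Q hQ => ?_⟩
  ext1 φ
  exact Lp_one_ext_setIntegral fun S hS => (hQ φ S hS).trans (hT φ S hS).symm

end PerronFrobeniusOperator

/-! ### Multiplication by characteristic functions on `L²`. -/

section MultiplicationOperators

variable {X : Type*} [MeasurableSpace X] {μ : Measure X}

theorem coeFn_sqL1 (φ : Lp ℂ 2 μ) : sqL1 φ =ᵐ[μ] fun x => φ x ^ 2 :=
  (memLp_sq φ).coeFn_toLp

/-- The multiplication operator on `L²(X, μ)` by the characteristic function of a measurable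
set. -/
noncomputable def indicatorL (μ : Measure X) {A : Set X} (hA : MeasurableSet A) :
    Lp ℂ 2 μ →L[ℂ] Lp ℂ 2 μ :=
  LinearMap.mkContinuous
    { toFun := fun φ => ((Lp.memLp φ).indicator hA).toLp _
      map_add' := fun φ ψ => by
        rw [← MemLp.toLp_add]
        refine MemLp.toLp_congr _ _ ?_
        filter_upwards [Lp.coeFn_add φ ψ] with x hx
        by_cases h : x ∈ A
        · simpa only [Pi.add_apply, Set.indicator_of_mem h] using hx
        · simp [h]
      map_smul' := fun c φ => by
        rw [RingHom.id_apply, ← MemLp.toLp_const_smul]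
        refine MemLp.toLp_congr _ _ ?_
        filter_upwards [Lp.coeFn_smul c φ] with x hx
        by_cases h : x ∈ A
        · simpa only [Pi.smul_apply, Set.indicator_of_mem h] using hx
        · simp [h] }
    1 fun φ => by
      rw [one_mul]
      refine Lp.norm_le_norm_of_ae_le ?_
      filter_upwards [((Lp.memLp φ).indicator hA).coeFn_toLp] with x hx
      exact hx ▸ norm_indicator_le_norm_self _ _

theorem coeFn_indicatorL {A : Set X} (hA : MeasurableSet A) (φ : Lp ℂ 2 μ) :
    indicatorL μ hA φ =ᵐ[μ] A.indicator φ :=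
  ((Lp.memLp φ).indicator hA).coeFn_toLp

theorem indicatorL_mul_indicatorL {A B C : Set X} (hA : MeasurableSet A) (hB : MeasurableSet B)
    (hC : MeasurableSet C) (h : (A ∩ B : Set X) =ᵐ[μ] C) :
    indicatorL μ hA * indicatorL μ hB = indicatorL μ hC := by
  ext1 φ
  refine Lp.ext ?_
  filter_upwards [coeFn_indicatorL hA (indicatorL μ hB φ), coeFn_indicatorL hB φ,
    coeFn_indicatorL hC φ, h.mem_iff] with x h1 h2 h3 h4
  rw [mul_apply_eq_comp, h1, h3]
  by_cases hxA : x ∈ A <;> by_cases hxB : x ∈ B <;> simp_all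

theorem indicatorL_congr {A B : Set X} (hA : MeasurableSet A) (hB : MeasurableSet B)
    (h : A =ᵐ[μ] B) : indicatorL μ hA = indicatorL μ hB := by
  ext1 φ
  refine Lp.ext ?_
  filter_upwards [coeFn_indicatorL hA φ, coeFn_indicatorL hB φ, h.mem_iff] with x h1 h2 h3
  rw [h1, h2]
  by_cases hxA : x ∈ A <;> simp_all

theorem isStarProjection_indicatorL {A : Set X} (hA : MeasurableSet A) :
    IsStarProjection (indicatorL μ hA) := by
  refine ⟨indicatorL_mul_indicatorL hA hA hA (.of_eq (Set.inter_self A)), ?_⟩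
  rw [ContinuousLinearMap.isSelfAdjoint_iff_isSymmetric]
  intro φ ψ
  simp only [ContinuousLinearMap.coe_coe, L2.inner_def]
  refine integral_congr_ae ?_
  filter_upwards [coeFn_indicatorL hA φ, coeFn_indicatorL hA ψ] with x h1 h2
  rw [h1, h2]
  by_cases hx : x ∈ A <;> simp [hx]

theorem indicatorL_eq_zero {A : Set X} (hA : MeasurableSet A) (h : A =ᵐ[μ] (∅ : Set X)) :
    indicatorL μ hA = 0 := by
  rw [indicatorL_congr hA .empty h]
  ext1 φ
  refine Lp.ext ?_
  filter_upwards [coeFn_indicatorL .empty φ, Lp.coeFn_zero ℂ 2 μ] with x h1 h2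
  rw [h1, Set.indicator_empty, zero_apply, h2]
  rfl

theorem indicatorL_union {A B C D : Set X} (hA : MeasurableSet A) (hB : MeasurableSet B)
    (hC : MeasurableSet C) (hD : MeasurableSet D) (h : (A ∪ B : Set X) =ᵐ[μ] C)
    (h' : (A ∩ B : Set X) =ᵐ[μ] D) :
    indicatorL μ hC = indicatorL μ hA + indicatorL μ hB - indicatorL μ hD := by
  ext1 φ
  refine Lp.ext ?_
  filter_upwards [coeFn_indicatorL hA φ, coeFn_indicatorL hB φ, coeFn_indicatorL hC φ,
    coeFn_indicatorL hD φ, h.mem_iff, h'.mem_iff,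
    Lp.coeFn_sub (indicatorL μ hA φ + indicatorL μ hB φ) (indicatorL μ hD φ),
    Lp.coeFn_add (indicatorL μ hA φ) (indicatorL μ hB φ)] with x h1 h2 h3 h4 h5 h6 h7 h8
  rw [sub_apply, add_apply, h7, Pi.sub_apply, h8,
    Pi.add_apply, h1, h2, h3, h4]
  by_cases hxA : x ∈ A <;> by_cases hxB : x ∈ B <;> simp_all

/-- The projections onto almost disjoint sets add up to the projection onto their union. -/
theorem sum_indicatorL {ι : Type*} (s : Finset ι) {R : ι → Set X}
    (hR : ∀ i, MeasurableSet (R i))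
    (hd : ∀ i j, i ≠ j → (R i ∩ R j : Set X) =ᵐ[μ] (∅ : Set X)) :
    ∑ i ∈ s, indicatorL μ (hR i) =
      indicatorL μ (A := ⋃ i ∈ s, R i) (s.measurableSet_biUnion fun i _ => hR i) := by
  classical
  induction s using Finset.induction_on with
  | empty => exact (indicatorL_eq_zero _ (by simp)).symm
  | insert a s ha ih =>
    have hz : indicatorL μ (.empty : MeasurableSet (∅ : Set X)) = 0 :=
      indicatorL_eq_zero .empty .rfl
    rw [Finset.sum_insert ha, ih, indicatorL_union (hR a) (s.measurableSet_biUnion fun i _ => hR i)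
      ((insert a s).measurableSet_biUnion fun i _ => hR i) .empty
      (.of_eq (Finset.set_biUnion_insert a s R).symm) ?_, hz, sub_zero]
    rw [Set.inter_iUnion₂, ae_eq_empty]
    refine (measure_biUnion_null_iff s.countable_toSet).2 fun i hi => ae_eq_empty.1 (hd a i (by rintro rfl; exact ha hi))

end MultiplicationOperators

/-! ### Weighted composition operators as partial isometries. -/

section WeightedComposition

variable {X : Type*} [MeasurableSpace X]

/-- The map `σ` with weight `w` carries a part `R` of `X` (essentially injectively) onto `D`, and
`w` is the density that makes `σ` measure preserving from `R` to `D`. -/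
structure IsWeightedSubstitution (μ : Measure X) (R D : Set X) (w : X → ℝ≥0∞) (σ : X → X) :
    Prop where
  measurableSet_range : MeasurableSet R
  measurableSet_domain : MeasurableSet D
  measurable_weight : Measurable w
  measurable_map : Measurable σ
  weight_lt_top : ∀ᵐ x ∂μ, w x < ∞
  weight_ne_zero : ∀ᵐ x ∂μ, w x ≠ 0 ↔ x ∈ R
  map_withDensity : (μ.withDensity w).map σ = μ.restrict D
  exists_leftInverse : ∃ τ : X → X, Measurable τ ∧ ∀ᵐ x ∂μ, x ∈ R → τ (σ x) = x

/-- The weighted composition `w^{1/2} · (φ ∘ σ)`. -/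
noncomputable def wcomp (w : X → ℝ≥0∞) (σ : X → X) (φ : X → ℂ) (x : X) : ℂ :=
  (Real.sqrt (w x).toReal : ℂ) * φ (σ x)

namespace IsWeightedSubstitution

variable {μ : Measure X} {R D : Set X} {w : X → ℝ≥0∞} {σ : X → X}
  (W : IsWeightedSubstitution μ R D w σ)
include W

/-- Pulling a null set back along `σ` gives a null set for `w μ`, because `w μ` is pushed to a
restriction of `μ`. This makes `wcomp` well defined on a.e. classes although `σ` is not assumed
nonsingular where `w` vanishes. -/
theorem ae_comp {p : X → Prop} (h : ∀ᵐ x ∂μ, p x) : ∀ᵐ x ∂μ, w x ≠ 0 → p (σ x) := by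
  rw [← ae_withDensity_iff W.measurable_weight]
  refine ae_of_ae_map W.measurable_map.aemeasurable ?_
  rw [W.map_withDensity]
  exact ae_restrict_of_ae h

theorem wcomp_congr {φ ψ : X → ℂ} (h : φ =ᵐ[μ] ψ) : wcomp w σ φ =ᵐ[μ] wcomp w σ ψ := by
  filter_upwards [W.ae_comp h] with x hx
  by_cases h0 : w x = 0
  · simp [wcomp, h0]
  · simp [wcomp, hx h0]

theorem aestronglyMeasurable_wcomp {φ : X → ℂ} (h : AEStronglyMeasurable φ μ) :
    AEStronglyMeasurable (wcomp w σ φ) μ := by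
  refine AEStronglyMeasurable.congr ?_ (W.wcomp_congr h.ae_eq_mk).symm
  refine AEStronglyMeasurable.mul ?_
    (h.stronglyMeasurable_mk.comp_measurable W.measurable_map).aestronglyMeasurable
  exact (Complex.measurable_ofReal.comp
    W.measurable_weight.ennreal_toReal.sqrt).aestronglyMeasurable

theorem lintegral_comp {g : X → ℝ≥0∞} (hg : AEMeasurable g μ) :
    ∫⁻ x, w x * g (σ x) ∂μ = ∫⁻ x in D, g x ∂μ := by
  rw [← W.map_withDensity, lintegral_map' _ W.measurable_map.aemeasurable,
    lintegral_withDensity_eq_lintegral_mul_non_measurable _ W.measurable_weight W.weight_lt_top]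
  · rfl
  · rw [W.map_withDensity]
    exact hg.restrict

theorem integral_comp {g : X → ℂ} (hg : AEStronglyMeasurable g μ) :
    ∫ x, (w x).toReal • g (σ x) ∂μ = ∫ x in D, g x ∂μ := by
  rw [← W.map_withDensity, integral_map W.measurable_map.aemeasurable,
    integral_withDensity_eq_integral_toReal_smul W.measurable_weight W.weight_lt_top]
  rw [W.map_withDensity]
  exact hg.restrict

/-- The integrand on the left is `w · (|φ|² ∘ σ)`, so this is the change of variables
`lintegral_comp`. -/
theorem eLpNorm_wcomp {φ : X → ℂ} (h : AEStronglyMeasurable φ μ) :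
    eLpNorm (wcomp w σ φ) 2 μ = eLpNorm (D.indicator φ) 2 μ := by
  rw [eLpNorm_indicator_eq_eLpNorm_restrict W.measurableSet_domain,
    eLpNorm_eq_lintegral_rpow_enorm_toReal (by norm_num) (by norm_num),
    eLpNorm_eq_lintegral_rpow_enorm_toReal (by norm_num) (by norm_num),
    ← W.lintegral_comp (h.enorm.pow_const _)]
  congr 1
  refine lintegral_congr_ae ?_
  filter_upwards [W.weight_lt_top] with x hx
  simp only [wcomp, enorm_mul, ENNReal.toReal_ofNat, ENNReal.rpow_two, mul_pow]
  congr 1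
  rw [← enorm_pow, ← Complex.ofReal_pow, Real.sq_sqrt ENNReal.toReal_nonneg]
  rw [← ofReal_norm, Complex.norm_real, Real.norm_of_nonneg ENNReal.toReal_nonneg,
    ENNReal.ofReal_toReal hx.ne]

theorem memLp_wcomp {φ : X → ℂ} (h : MemLp φ 2 μ) : MemLp (wcomp w σ φ) 2 μ := by
  refine ⟨W.aestronglyMeasurable_wcomp h.1, ?_⟩
  rw [W.eLpNorm_wcomp h.1]
  exact (h.indicator W.measurableSet_domain).2

/-- The operator `φ ↦ w^{1/2} · (φ ∘ σ)` on `L²(X, μ)`. -/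
noncomputable def toCLM : Lp ℂ 2 μ →L[ℂ] Lp ℂ 2 μ :=
  LinearMap.mkContinuous
    { toFun := fun φ => (W.memLp_wcomp (Lp.memLp φ)).toLp _
      map_add' := fun φ ψ => by
        rw [← MemLp.toLp_add]
        refine MemLp.toLp_congr _ _ ((W.wcomp_congr (Lp.coeFn_add φ ψ)).trans (ae_of_all _ ?_))
        intro x
        simp [wcomp, mul_add]
      map_smul' := fun c φ => by
        rw [RingHom.id_apply, ← MemLp.toLp_const_smul]
        refine MemLp.toLp_congr _ _ ((W.wcomp_congr (Lp.coeFn_smul c φ)).trans (ae_of_all _ ?_))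
        intro x
        simp [wcomp, mul_left_comm] }
    1 fun φ => by
      rw [one_mul, LinearMap.coe_mk, AddHom.coe_mk, Lp.norm_toLp,
        W.eLpNorm_wcomp (Lp.aestronglyMeasurable φ), Lp.norm_def]
      exact ENNReal.toReal_mono (Lp.eLpNorm_ne_top φ) (eLpNorm_indicator_le _)

theorem coeFn_toCLM (φ : Lp ℂ 2 μ) : W.toCLM φ =ᵐ[μ] wcomp w σ φ :=
  (W.memLp_wcomp (Lp.memLp φ)).coeFn_toLp

theorem star_toCLM_mul_toCLM :
    star W.toCLM * W.toCLM = indicatorL μ W.measurableSet_domain := by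
  ext1 φ
  refine ext_inner_right ℂ fun ψ => ?_
  rw [mul_apply_eq_comp, ContinuousLinearMap.star_eq_adjoint,
    ContinuousLinearMap.adjoint_inner_left, L2.inner_def, L2.inner_def]
  have hm : AEStronglyMeasurable (fun x => inner ℂ (φ x) (ψ x)) μ :=
    (Lp.aestronglyMeasurable φ).inner (Lp.aestronglyMeasurable ψ)
  calc ∫ x, inner ℂ (W.toCLM φ x) (W.toCLM ψ x) ∂μ
      = ∫ x, (w x).toReal • inner ℂ (φ (σ x)) (ψ (σ x)) ∂μ := by
        refine integral_congr_ae ?_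
        filter_upwards [W.coeFn_toCLM φ, W.coeFn_toCLM ψ] with x h1 h2
        have h3 : (Real.sqrt (w x).toReal : ℂ) * Real.sqrt (w x).toReal = (w x).toReal := by
          rw [← Complex.ofReal_mul, Real.mul_self_sqrt ENNReal.toReal_nonneg]
        rw [h1, h2, Complex.real_smul, ← h3]
        simp only [wcomp, RCLike.inner_apply, map_mul, Complex.conj_ofReal]
        ring
    _ = ∫ x in D, inner ℂ (φ x) (ψ x) ∂μ := W.integral_comp hm
    _ = ∫ x, inner ℂ (indicatorL μ W.measurableSet_domain φ x) (ψ x) ∂μ := by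
        rw [← integral_indicator W.measurableSet_domain]
        refine integral_congr_ae ?_
        filter_upwards [coeFn_indicatorL W.measurableSet_domain φ] with x hx
        rw [hx]
        by_cases h : x ∈ D <;> simp [h]

theorem norm_toCLM (φ : Lp ℂ 2 μ) :
    ‖W.toCLM φ‖ = ‖indicatorL μ W.measurableSet_domain φ‖ := by
  rw [Lp.norm_def, Lp.norm_def, eLpNorm_congr_ae (W.coeFn_toCLM φ),
    eLpNorm_congr_ae (coeFn_indicatorL W.measurableSet_domain φ),
    W.eLpNorm_wcomp (Lp.aestronglyMeasurable φ)]

/-- By `norm_toCLM` the operator kills every function that vanishes on `D`, in particular `1_D φ -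
φ`. -/
theorem toCLM_mul_indicatorL : W.toCLM * indicatorL μ W.measurableSet_domain = W.toCLM := by
  ext1 φ
  rw [← sub_eq_zero, mul_apply_eq_comp, ← map_sub, ← norm_eq_zero, W.norm_toCLM,
    map_sub, ← mul_apply_eq_comp (indicatorL μ _),
    (isStarProjection_indicatorL W.measurableSet_domain).isIdempotentElem.eq, sub_self, norm_zero]

theorem toCLM_mul_star_mul_toCLM : W.toCLM * star W.toCLM * W.toCLM = W.toCLM := by
  rw [mul_assoc, W.star_toCLM_mul_toCLM, W.toCLM_mul_indicatorL]

theorem indicatorL_mul_toCLM : indicatorL μ W.measurableSet_range * W.toCLM = W.toCLM := by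
  ext1 φ
  refine Lp.ext ?_
  filter_upwards [coeFn_indicatorL W.measurableSet_range (W.toCLM φ), W.coeFn_toCLM φ,
    W.weight_ne_zero] with x h1 h2 h3
  rw [mul_apply_eq_comp, h1]
  by_cases hx : x ∈ R
  · simp [hx]
  · simp [hx, h2, wcomp, not_not.1 (mt h3.1 hx)]

/-- Surjectivity onto `L²(R)`: the weight is nonzero a.e. on `R` and `σ` has a left inverse there,
so the equation can be solved pointwise. -/
theorem exists_toCLM_eq (ψ : Lp ℂ 2 μ) :
    ∃ φ, W.toCLM φ = indicatorL μ W.measurableSet_range ψ := by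
  obtain ⟨τ, hτ, hτσ⟩ := W.exists_leftInverse
  let φ : X → ℂ := D.indicator fun y => (Real.sqrt (w (τ y)).toReal : ℂ)⁻¹ * ψ (τ y)
  have hφm : AEStronglyMeasurable φ μ := by
    refine (StronglyMeasurable.indicator ?_ W.measurableSet_domain).aestronglyMeasurable
    refine StronglyMeasurable.mul ?_ ((Lp.stronglyMeasurable ψ).comp_measurable hτ)
    exact (Complex.measurable_ofReal.comp
      (W.measurable_weight.comp hτ).ennreal_toReal.sqrt).inv.stronglyMeasurable
  have hD : ∀ᵐ x ∂μ, w x ≠ 0 → σ x ∈ D := by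
    rw [← ae_withDensity_iff W.measurable_weight]
    refine ae_of_ae_map W.measurable_map.aemeasurable ?_
    rw [W.map_withDensity]
    exact ae_restrict_mem W.measurableSet_domain
  have hφ : wcomp w σ φ =ᵐ[μ] R.indicator ψ := by
    filter_upwards [hD, hτσ, W.weight_ne_zero, W.weight_lt_top] with x h1 h2 h3 h4
    by_cases hx : x ∈ R
    · have h0 : (Real.sqrt (w x).toReal : ℂ) ≠ 0 := by
        rw [Complex.ofReal_ne_zero, Real.sqrt_ne_zero']
        exact ENNReal.toReal_pos (h3.2 hx) h4.ne
      simp only [wcomp, φ, Set.indicator_of_mem (h1 (h3.2 hx)), h2 hx, Set.indicator_of_mem hx]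
      rw [mul_inv_cancel_left₀ h0]
    · simp [hx, wcomp, not_not.1 (mt h3.1 hx)]
  -- No estimate on `τ` is needed: `φ` lives on `D`, so its norm equals that of `wcomp w σ φ`, which
  -- is `1_R ψ`.
  have hφL : MemLp φ 2 μ := by
    refine ⟨hφm, ?_⟩
    have h1 : D.indicator φ = φ := by simp [φ, Set.indicator_indicator]
    rw [← h1, ← W.eLpNorm_wcomp hφm, eLpNorm_congr_ae hφ]
    exact ((Lp.memLp ψ).indicator W.measurableSet_range).2
  refine ⟨hφL.toLp φ, Lp.ext ?_⟩
  exact (W.coeFn_toCLM _).trans ((W.wcomp_congr hφL.coeFn_toLp).trans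
    (hφ.trans (coeFn_indicatorL _ ψ).symm))

/-- Since the range of `T = W.toCLM` lies in `L²(R)`, `T T*` factors through `1_R`. Every `1_R ψ` is
of the form `T φ`, and `T T* T = T` shows that `T T*` fixes it. -/
theorem toCLM_mul_star : W.toCLM * star W.toCLM = indicatorL μ W.measurableSet_range := by
  have h1 : W.toCLM * star W.toCLM =
      W.toCLM * star W.toCLM * indicatorL μ W.measurableSet_range := by
    have := congrArg star W.indicatorL_mul_toCLM
    rw [star_mul, (isStarProjection_indicatorL W.measurableSet_range).isSelfAdjoint.star_eq] at this
    rw [mul_assoc, this]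
  rw [h1]
  ext1 ψ
  obtain ⟨φ, hφ⟩ := W.exists_toCLM_eq ψ
  rw [mul_apply_eq_comp, ← hφ, ← mul_apply_eq_comp,
    W.toCLM_mul_star_mul_toCLM]

theorem indicatorL_mul_star_toCLM :
    indicatorL μ W.measurableSet_domain * star W.toCLM = star W.toCLM := by
  have := congrArg star W.toCLM_mul_indicatorL
  rwa [star_mul, (isStarProjection_indicatorL W.measurableSet_domain).isSelfAdjoint.star_eq] at this

/-- The Perron-Frobenius operator of a map that agrees with `σ` on `R` acts on squares of functions
supported in `R` through the adjoint of the weighted composition operator. -/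
theorem sqL1_star_toCLM {F : X → X} (hF : Measurable F)
    (hFσ : ∀ᵐ x ∂μ, x ∈ R → F x = σ x) {P : Lp ℂ 1 μ →L[ℂ] Lp ℂ 1 μ}
    (hP : IsPerronFrobenius F P) (φ : Lp ℂ 2 μ) :
    sqL1 (star W.toCLM φ) = P (sqL1 (indicatorL μ W.measurableSet_range φ)) := by
  have hS : indicatorL μ W.measurableSet_range φ = W.toCLM (star W.toCLM φ) := by
    rw [← W.toCLM_mul_star, mul_apply_eq_comp]
  have hD := coeFn_indicatorL W.measurableSet_domain (star W.toCLM φ)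
  rw [← mul_apply_eq_comp, W.indicatorL_mul_star_toCLM] at hD
  rw [hS]
  set ψ := star W.toCLM φ
  refine Lp_one_ext_setIntegral fun S hS => ?_
  rw [hP _ S hS, integral_congr_ae (ae_restrict_of_ae (coeFn_sqL1 ψ)),
    integral_congr_ae (ae_restrict_of_ae (coeFn_sqL1 (W.toCLM ψ))),
    ← integral_indicator hS, ← integral_indicator (hF hS)]
  have hm : AEStronglyMeasurable (S.indicator fun x => ψ x ^ 2) μ :=
    ((Lp.aestronglyMeasurable ψ).pow 2).indicator hS
  -- Both integrals are compared with the integral of `1_S ψ²` over `D`: the left one because `ψ`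
  -- vanishes a.e. off `D`, the right one by the change of variables `integral_comp`.
  trans ∫ x in D, S.indicator (fun x => ψ x ^ 2) x ∂μ
  · rw [← integral_indicator W.measurableSet_domain]
    refine integral_congr_ae ?_
    filter_upwards [hD] with x hx
    by_cases hxD : x ∈ D
    · rw [Set.indicator_of_mem hxD]
    · rw [Set.indicator_of_notMem hxD] at hx ⊢
      by_cases hxS : x ∈ S <;> simp [hxS, hx]
  · rw [← W.integral_comp hm]
    refine integral_congr_ae ?_
    filter_upwards [W.coeFn_toCLM ψ, hFσ, W.weight_ne_zero] with x h1 h2 h3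
    by_cases hx : x ∈ R
    · have h4 : (F ⁻¹' S).indicator (fun x => W.toCLM ψ x ^ 2) x =
          (σ ⁻¹' S).indicator (fun x => W.toCLM ψ x ^ 2) x := by
        classical simp only [Set.indicator_apply, Set.mem_preimage, h2 hx]
      rw [h4]
      by_cases hxS : σ x ∈ S
      · rw [Set.indicator_of_mem hxS, Set.indicator_of_mem (Set.mem_preimage.2 hxS), h1, wcomp,
          mul_pow, ← Complex.ofReal_pow, Real.sq_sqrt ENNReal.toReal_nonneg, Complex.real_smul]
      · rw [Set.indicator_of_notMem hxS, Set.indicator_of_notMem (by exact hxS), smul_zero]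
    -- Off `R` nothing is known about `F`, but both integrands vanish because the weight does.
    · have h0 : w x = 0 := not_not.1 (mt h3.1 hx)
      rw [h0, ENNReal.toReal_zero, zero_smul, eq_comm, Set.indicator_apply_eq_zero]
      simp [h1, wcomp, h0]

end IsWeightedSubstitution

end WeightedComposition

/-! ### The representation induced by a branching system. -/

namespace Ultragraph.BranchingSystem

variable {V : Type v} {E : Type e} {X : Type u} [MeasurableSpace X]
  {G : Ultragraph V E} {μ : Measure X} (B : G.BranchingSystem μ)

open Classical in
/-- The map `(f e)⁻¹`, extended by the identity outside `R e`. -/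
noncomputable def extFinv (e : E) (x : X) : X :=
  if h : x ∈ B.R e then B.finv e ⟨x, h⟩ else x

open Classical in
/-- The map `f e`, extended by the identity outside its domain. -/
noncomputable def extF (e : E) (x : X) : X :=
  if h : x ∈ B.D (GVertex.edgeRange G e) then B.f e ⟨x, h⟩ else x

open Classical in
/-- The Radon-Nikodym derivative `d(μ ∘ (f e)⁻¹)/dμ`, extended by zero outside `R e`. -/
noncomputable def extPhi (e : E) (x : X) : ℝ≥0∞ :=
  if h : x ∈ B.R e then B.Phi_finv e ⟨x, h⟩ else 0

open Classical in
theorem measurable_extFinv (e : E) : Measurable (B.extFinv e) :=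
  Measurable.dite (measurable_subtype_coe.comp (B.measurable_finv e)) measurable_subtype_coe
    (B.measurableSet_R e)

open Classical in
theorem measurable_extF (e : E) : Measurable (B.extF e) :=
  Measurable.dite (measurable_subtype_coe.comp (B.measurable_f e)) measurable_subtype_coe
    (B.measurableSet_D _)

open Classical in
theorem measurable_extPhi (e : E) : Measurable (B.extPhi e) :=
  Measurable.dite (Measure.measurable_rnDeriv _ _) measurable_const (B.measurableSet_R e)

theorem weightedComp_eq_wcomp (e : E) (φ : X → ℂ) :
    B.weightedComp e φ = wcomp (B.extPhi e) (B.extFinv e) φ := by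
  ext x
  by_cases h : x ∈ B.R e <;> simp [weightedComp, wcomp, extPhi, extFinv, h]

theorem ae_mem_imp_of_ae_onSubset {A : Set X} (hA : MeasurableSet A) {p : X → Prop}
    (h : ∀ᵐ x : A ∂(onSubset μ A), p x) : ∀ᵐ x ∂μ, x ∈ A → p x := by
  rw [← ae_restrict_iff' hA, ← map_comap_subtype_coe hA]
  exact ((MeasurableEmbedding.subtype_coe hA).ae_map_iff).2 h

/-- The measure `μ ∘ (f e)⁻¹` on `R e`. -/
noncomputable abbrev mapF (e : E) : Measure (B.R e) :=
  (onSubset μ (B.D (GVertex.edgeRange G e))).map (B.f e)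

theorem map_finv_mapF (e : E) :
    (B.mapF e).map (B.finv e) = onSubset μ (B.D (GVertex.edgeRange G e)) := by
  rw [Measure.map_map (B.measurable_finv e) (B.measurable_f e),
    Measure.map_congr (show B.finv e ∘ B.f e =ᵐ[_] id from B.finv_f e), Measure.map_id]

theorem sigmaFinite_onSubset [SigmaFinite μ] {A : Set X} (hA : MeasurableSet A) :
    SigmaFinite (onSubset μ A) := by
  refine SigmaFinite.of_map _ measurable_subtype_coe.aemeasurable ?_
  rw [map_comap_subtype_coe hA]
  infer_instance

/-- A pushforward of a σ-finite measure need not be σ-finite. Here it is, because pushing it on by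
`finv e` gives back the σ-finite measure on the domain of `f e`. -/
theorem sigmaFinite_mapF [SigmaFinite μ] (e : E) : SigmaFinite (B.mapF e) := by
  refine SigmaFinite.of_map _ (B.measurable_finv e).aemeasurable ?_
  rw [B.map_finv_mapF e]
  exact sigmaFinite_onSubset (B.measurableSet_D _)

/-- If the preimage of `N` under `f e` is null, then so is its preimage under `finv e`, which is `N`
up to a null set. This is what makes `Φ` positive a.e. on `R e`. -/
theorem onSubset_absolutelyContinuous_mapF (e : E) : onSubset μ (B.R e) ≪ B.mapF e := by
  refine Measure.AbsolutelyContinuous.mk fun N hN h0 => ?_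
  rw [Measure.map_apply (B.measurable_f e) hN] at h0
  have h1 := B.map_finv_ac e h0
  rw [Measure.map_apply (B.measurable_finv e) (B.measurable_f e hN)] at h1
  refine (measure_congr ?_).trans h1
  filter_upwards [B.f_finv e] with x hx
  change (x ∈ N) = (B.f e (B.finv e x) ∈ N)
  rw [hx]

theorem isWeightedSubstitution [SigmaFinite μ] (e : E) :
    IsWeightedSubstitution μ (B.R e) (B.D (GVertex.edgeRange G e)) (B.extPhi e)
      (B.extFinv e) := by
  have := sigmaFinite_onSubset (μ := μ) (B.measurableSet_R e)
  have := B.sigmaFinite_mapF e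
  refine ⟨B.measurableSet_R e, B.measurableSet_D _, B.measurable_extPhi e,
    B.measurable_extFinv e, ?_, ?_, ?_, B.extF e, B.measurable_extF e, ?_⟩
  · have h : ∀ᵐ x ∂μ, x ∈ B.R e → B.extPhi e x < ∞ := by
      refine ae_mem_imp_of_ae_onSubset (B.measurableSet_R e) ?_
      filter_upwards [Measure.rnDeriv_lt_top (B.mapF e) (onSubset μ (B.R e))] with x hx
      simpa [extPhi, Phi_finv] using hx
    filter_upwards [h] with x hx
    by_cases hxR : x ∈ B.R e
    · exact hx hxR
    · simp [extPhi, hxR]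
  · have h : ∀ᵐ x ∂μ, x ∈ B.R e → B.extPhi e x ≠ 0 := by
      refine ae_mem_imp_of_ae_onSubset (B.measurableSet_R e) ?_
      filter_upwards [Measure.rnDeriv_pos' (B.onSubset_absolutelyContinuous_mapF e)] with x hx
      simpa [extPhi, Phi_finv] using hx.ne'
    filter_upwards [h] with x hx
    refine ⟨fun h0 => ?_, hx⟩
    by_contra hxR
    exact h0 (by simp [extPhi, hxR])
  -- Both sides equal the integral of `Φ` over the preimage of `S` in `R e`. The extended weight
  -- vanishes off `R e`, so passing from the subtype to `X` adds nothing.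
  · ext S hS
    have hS' := measurable_subtype_coe (p := (· ∈ B.D (GVertex.edgeRange G e))) hS
    have hD : μ.restrict (B.D (GVertex.edgeRange G e)) S =
        ∫⁻ x : B.R e, (B.extFinv e ⁻¹' S).indicator (B.extPhi e) x ∂(onSubset μ (B.R e)) := by
      rw [← map_comap_subtype_coe (B.measurableSet_D _), Measure.map_apply measurable_subtype_coe hS]
      change onSubset μ _ _ = _
      rw [← B.map_finv_mapF e, Measure.map_apply (B.measurable_finv e) hS',
        ← Measure.withDensity_rnDeriv_eq (B.mapF e) (onSubset μ (B.R e)) (B.map_f_ac e),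
        withDensity_apply _ (B.measurable_finv e hS'),
        ← lintegral_indicator (B.measurable_finv e hS')]
      refine lintegral_congr fun x => ?_
      by_cases hx : (B.finv e x : X) ∈ S <;> simp [Set.indicator, extFinv, extPhi, Phi_finv, hx]
    rw [hD, lintegral_subtype_comap (B.measurableSet_R e),
      Measure.map_apply (B.measurable_extFinv e) hS,
      withDensity_apply _ (B.measurable_extFinv e hS),
      ← lintegral_indicator (B.measurable_extFinv e hS),
      ← lintegral_add_compl _ (B.measurableSet_R e),
      setLIntegral_eq_zero (B.measurableSet_R e).compl, add_zero]
    intro x hx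
    rw [Pi.zero_apply, Set.indicator_apply_eq_zero]
    exact fun _ => dif_neg hx
  · refine ae_mem_imp_of_ae_onSubset (B.measurableSet_R e) ?_
    filter_upwards [B.f_finv e] with x hx
    simp [extFinv, extF, hx]

/-- The Cuntz-Krieger family of operators on `L²(X, μ)` given by a branching system. -/
noncomputable def ckFamily [SigmaFinite μ] : G.CKFamily (Lp ℂ 2 μ →L[ℂ] Lp ℂ 2 μ) where
  S e := (B.isWeightedSubstitution e).toCLM
  P A := indicatorL μ (B.measurableSet_D A)
  isPartialIsometry e := (B.isWeightedSubstitution e).toCLM_mul_star_mul_toCLM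
  orthogonal_ranges e f h := by
    rw [IsWeightedSubstitution.toCLM_mul_star, IsWeightedSubstitution.toCLM_mul_star,
      indicatorL_mul_indicatorL _ _ .empty (B.R_disjoint e f h), indicatorL_eq_zero _ .rfl]
  isProjection A := isStarProjection_indicatorL _
  P_empty := indicatorL_eq_zero _ (.of_eq B.D_empty)
  P_inter A C := indicatorL_mul_indicatorL _ _ _ (B.D_inter A C)
  P_union A C := indicatorL_union _ _ _ _ (B.D_union A C) (B.D_inter A C)
  star_S_mul_S e := (B.isWeightedSubstitution e).star_toCLM_mul_toCLM
  range_le e := by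
    rw [IsWeightedSubstitution.toCLM_mul_star]
    refine indicatorL_mul_indicatorL _ _ _ ?_
    filter_upwards [B.R_subset e] with x hx
    exact propext ⟨fun h => h.2, fun h => ⟨hx h, h⟩⟩
  P_vertex v T hT hne := by
    simp_rw [IsWeightedSubstitution.toCLM_mul_star]
    rw [sum_indicatorL T B.measurableSet_R B.R_disjoint]
    have hset : {e | G.s e = v} = (T : Set E) := by ext e; simp [hT e]
    refine indicatorL_congr _ _ ((B.D_vertex v ?_ ?_).trans (.of_eq ?_))
    · rw [hset]; exact hne
    · rw [hset]; exact T.finite_toSet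
    · rw [hset]; rfl

/-- Turns the a.e. formulas into equalities of operators, so that the universal property of `C*(G)`
applies. -/
theorem isInducedRep_iff [SigmaFinite μ]
    (π : CStarAlg.{v, e, u} G →⋆ₙₐ[ℂ] (Lp ℂ 2 μ →L[ℂ] Lp ℂ 2 μ)) :
    B.IsInducedRep π ↔ (∀ e, π (genS.{v, e, u} G e) = B.ckFamily.S e) ∧
      ∀ A, π (genP.{v, e, u} G A) = B.ckFamily.P A := by
  refine and_congr (forall_congr' fun e => ?_) (forall_congr' fun A => ?_)
  · rw [ContinuousLinearMap.ext_iff]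
    refine forall_congr' fun φ => ?_
    rw [weightedComp_eq_wcomp, Lp.ext_iff]
    have h := (B.isWeightedSubstitution e).coeFn_toCLM φ
    exact ⟨fun h' => h'.trans h.symm, fun h' => h'.trans h⟩
  · rw [ContinuousLinearMap.ext_iff]
    refine forall_congr' fun φ => ?_
    rw [Lp.ext_iff]
    have h := coeFn_indicatorL (B.measurableSet_D A) φ
    exact ⟨fun h' => h'.trans h.symm, fun h' => h'.trans h⟩

theorem existsUnique_isInducedRep [SigmaFinite μ] :
    ∃! π : CStarAlg.{v, e, u} G →⋆ₙₐ[ℂ] (Lp ℂ 2 μ →L[ℂ] Lp ℂ 2 μ), B.IsInducedRep π := by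
  simp_rw [isInducedRep_iff]
  exact existsUnique_lift G B.ckFamily

theorem IsInducedRep.sqL1_star_genS [SigmaFinite μ] {B : G.BranchingSystem μ}
    {π : CStarAlg.{v, e, u} G →⋆ₙₐ[ℂ] (Lp ℂ 2 μ →L[ℂ] Lp ℂ 2 μ)} (hπ : B.IsInducedRep π)
    {F : X → X} (hF : Measurable F) (hFB : B.AgreesWith F) {P : Lp ℂ 1 μ →L[ℂ] Lp ℂ 1 μ}
    (hP : IsPerronFrobenius F P) (e : E) (φ : Lp ℂ 2 μ) :
    sqL1 (π (star (genS.{v, e, u} G e)) φ) =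
      P (sqL1 (indicatorL μ (B.measurableSet_R e) φ)) := by
  rw [map_star, ((B.isInducedRep_iff π).1 hπ).1 e]
  refine (B.isWeightedSubstitution e).sqL1_star_toCLM hF ?_ hP φ
  refine ae_mem_imp_of_ae_onSubset (B.measurableSet_R e) ?_
  filter_upwards [hFB e] with x hx
  simpa [extFinv] using hx

end Ultragraph.BranchingSystem

/-! ### Decomposition of squares along almost disjoint sets. -/

section SumsOfSquares

variable {X : Type*} [MeasurableSpace X] {μ : Measure X}

theorem coeFn_sqL1_indicatorL {A : Set X} (hA : MeasurableSet A) (φ : Lp ℂ 2 μ) :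
    sqL1 (indicatorL μ hA φ) =ᵐ[μ] A.indicator (sqL1 φ) := by
  filter_upwards [coeFn_sqL1 (indicatorL μ hA φ), coeFn_indicatorL hA φ, coeFn_sqL1 φ]
    with x h1 h2 h3
  rw [h1, h2]
  by_cases hx : x ∈ A <;> simp [hx, h3]

/-- Squaring is not additive, but the cross term of two almost disjoint cut-offs vanishes a.e. -/
theorem sqL1_indicatorL_union {A B C : Set X} (hA : MeasurableSet A) (hB : MeasurableSet B)
    (hC : MeasurableSet C) (h : A ∪ B = C) (h' : (A ∩ B : Set X) =ᵐ[μ] (∅ : Set X))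
    (φ : Lp ℂ 2 μ) :
    sqL1 (indicatorL μ hC φ) = sqL1 (indicatorL μ hA φ) + sqL1 (indicatorL μ hB φ) := by
  subst h
  refine Lp.ext ?_
  filter_upwards [coeFn_sqL1_indicatorL hA φ, coeFn_sqL1_indicatorL hB φ,
    coeFn_sqL1_indicatorL hC φ, h'.mem_iff,
    Lp.coeFn_add (sqL1 (indicatorL μ hA φ)) (sqL1 (indicatorL μ hB φ))] with x h1 h2 h3 h4 h5
  rw [h5, Pi.add_apply, h1, h2, h3]
  by_cases hxA : x ∈ A <;> by_cases hxB : x ∈ B <;> simp_all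

theorem sum_sqL1_indicatorL {ι : Type*} (s : Finset ι) {R : ι → Set X}
    (hR : ∀ i, MeasurableSet (R i))
    (hd : ∀ i j, i ≠ j → (R i ∩ R j : Set X) =ᵐ[μ] (∅ : Set X)) (φ : Lp ℂ 2 μ) :
    ∑ i ∈ s, sqL1 (indicatorL μ (hR i) φ) =
      sqL1 (indicatorL μ (A := ⋃ i ∈ s, R i) (s.measurableSet_biUnion fun i _ => hR i) φ) := by
  classical
  induction s using Finset.induction_on with
  | empty =>
    refine Lp.ext ?_
    filter_upwards [coeFn_sqL1_indicatorL
      ((∅ : Finset ι).measurableSet_biUnion fun i _ => hR i) φ, Lp.coeFn_zero ℂ 1 μ] with x h1 h2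
    rw [h1, Finset.sum_empty, h2]
    simp
  | insert a s ha ih =>
    rw [Finset.sum_insert ha, ih, ← sqL1_indicatorL_union]
    · exact (Finset.set_biUnion_insert a s R).symm
    · rw [Set.inter_iUnion₂, ae_eq_empty]
      refine (measure_biUnion_null_iff s.countable_toSet).2 fun i hi =>
        ae_eq_empty.1 (hd a i (by rintro rfl; exact ha hi))

theorem indicatorL_eq_self {A : Set X} (hA : MeasurableSet A) {φ : Lp ℂ 2 μ}
    (h : Function.support φ ≤ᵐ[μ] A) : indicatorL μ hA φ = φ := by
  refine Lp.ext ?_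
  filter_upwards [coeFn_indicatorL hA φ, h] with x h1 h2
  rw [h1, Set.indicator_apply_eq_self]
  exact fun hx => not_not.1 fun h0 => hx (h2 h0)

theorem sum_univ_sqL1_indicatorL {ι : Type*} [Fintype ι] {R : ι → Set X}
    (hR : ∀ i, MeasurableSet (R i))
    (hd : ∀ i j, i ≠ j → (R i ∩ R j : Set X) =ᵐ[μ] (∅ : Set X)) {φ : Lp ℂ 2 μ}
    (h : Function.support φ ≤ᵐ[μ] (⋃ i, R i : Set X)) :
    ∑ i, sqL1 (indicatorL μ (hR i) φ) = sqL1 φ := by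
  rw [sum_sqL1_indicatorL _ hR hd, indicatorL_eq_self]
  simpa using h

/-- The partial sums are `φ²` cut off to the first `n` sets. They are dominated by `|φ²|` and at
almost every point are eventually constant, so dominated convergence applies. -/
theorem tendsto_sum_sqL1_indicatorL {R : ℕ → Set X} (hR : ∀ i, MeasurableSet (R i))
    (hd : ∀ i j, i ≠ j → (R i ∩ R j : Set X) =ᵐ[μ] (∅ : Set X)) {φ : Lp ℂ 2 μ}
    (h : Function.support φ ≤ᵐ[μ] (⋃ i, R i : Set X)) :
    Tendsto (fun n => ∑ i ∈ Finset.range n, sqL1 (indicatorL μ (hR i) φ)) atTop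
      (𝓝 (sqL1 φ)) := by
  simp_rw [sum_sqL1_indicatorL _ hR hd]
  have hA : ∀ n, MeasurableSet (⋃ i ∈ Finset.range n, R i) := fun n =>
    (Finset.range n).measurableSet_biUnion fun i _ => hR i
  have hind : ∀ n, _ := fun n => coeFn_sqL1_indicatorL (hA n) φ
  rw [Lp.tendsto_Lp_iff_tendsto_eLpNorm']
  simp_rw [eLpNorm_one_eq_lintegral_enorm, ← ofReal_norm, Pi.sub_apply]
  refine tendsto_lintegral_norm_of_dominated_convergence (bound := fun x => ‖sqL1 φ x‖)
    (fun n => Lp.aestronglyMeasurable _) (L1.integrable_coeFn (sqL1 φ)).norm.2 (fun n => ?_) ?_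
  · filter_upwards [hind n] with x hx
    rw [hx]
    exact norm_indicator_le_norm_self _ _
  · filter_upwards [ae_all_iff.2 hind, h, coeFn_sqL1 φ] with x h1 h2 h3
    simp_rw [h1]
    by_cases hx : φ x = 0
    · have h0 : sqL1 φ x = 0 := by rw [h3, hx]; simp
      have h0' : ∀ A : Set X, A.indicator (sqL1 φ) x = 0 := fun A =>
        Set.indicator_apply_eq_zero.2 fun _ => h0
      simp_rw [h0', h0]
      exact tendsto_const_nhds
    · obtain ⟨i, hi⟩ := Set.mem_iUnion.1 (h2 hx)
      refine tendsto_const_nhds.congr' ?_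
      filter_upwards [eventually_gt_atTop i] with n hn
      exact (Set.indicator_of_mem (Set.mem_biUnion (Finset.mem_range.2 hn) hi) _).symm

/-- Nonnegativity is essential, since `Real.sqrt` sends negative numbers to `0`. -/
theorem coeFn_sqL1_sqrtL2 {η : Lp ℝ 1 μ} (h : 0 ≤ η) :
    sqL1 (sqrtL2 η) =ᵐ[μ] fun x => (η x : ℂ) := by
  filter_upwards [coeFn_sqL1 (sqrtL2 η), (memLp_sqrt η).coeFn_toLp, (Lp.coeFn_nonneg η).2 h]
    with x h1 h2 h3
  rw [h1, sqrtL2, h2, ← Complex.ofReal_pow, Real.sq_sqrt h3]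

theorem support_sqrtL2_ae_le {η : Lp ℝ 1 μ} {A : Set X} (h : Function.support η ≤ᵐ[μ] A) :
    Function.support (sqrtL2 η) ≤ᵐ[μ] A := by
  filter_upwards [h, (memLp_sqrt η).coeFn_toLp] with x h1 h2 h3
  refine h1 fun h0 => h3 ?_
  rw [sqrtL2, h2, h0]
  simp

theorem eq_sqL1_sqrtL2_combination {η : Lp ℂ 1 μ} {η₁ η₂ η₃ η₄ : Lp ℝ 1 μ}
    (h₁ : 0 ≤ η₁) (h₂ : 0 ≤ η₂) (h₃ : 0 ≤ η₃) (h₄ : 0 ≤ η₄)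
    (h : η =ᵐ[μ] fun x => (η₁ x : ℂ) - η₂ x + Complex.I * ((η₃ x : ℂ) - η₄ x)) :
    η = sqL1 (sqrtL2 η₁) - sqL1 (sqrtL2 η₂) + Complex.I • sqL1 (sqrtL2 η₃)
      - Complex.I • sqL1 (sqrtL2 η₄) := by
  refine Lp.ext ?_
  filter_upwards [h, coeFn_sqL1_sqrtL2 h₁, coeFn_sqL1_sqrtL2 h₂, coeFn_sqL1_sqrtL2 h₃,
    coeFn_sqL1_sqrtL2 h₄,
    Lp.coeFn_sub (sqL1 (sqrtL2 η₁) - sqL1 (sqrtL2 η₂) + Complex.I • sqL1 (sqrtL2 η₃))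
      (Complex.I • sqL1 (sqrtL2 η₄)),
    Lp.coeFn_add (sqL1 (sqrtL2 η₁) - sqL1 (sqrtL2 η₂)) (Complex.I • sqL1 (sqrtL2 η₃)),
    Lp.coeFn_sub (sqL1 (sqrtL2 η₁)) (sqL1 (sqrtL2 η₂)),
    Lp.coeFn_smul Complex.I (sqL1 (sqrtL2 η₃)),
    Lp.coeFn_smul Complex.I (sqL1 (sqrtL2 η₄))] with x h e1 e2 e3 e4 e5 e6 e7 e8 e9
  simp only [h, e1, e2, e3, e4, e5, e6, e7, e8, e9, Pi.sub_apply, Pi.add_apply, Pi.smul_apply,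
    smul_eq_mul]
  ring

end SumsOfSquares

/-! ### The main theorem. -/

theorem mainTheorem7 {V : Type v} {E : Type e} {X : Type u} [MeasurableSpace X]
    (μ : Measure X) [SigmaFinite μ] (G : Ultragraph V E) (B : G.BranchingSystem μ)
    (F : X → X) (hF : Measure.QuasiMeasurePreserving F μ μ) (hFB : B.AgreesWith F) :
    (∃! π : Ultragraph.CStarAlg.{v, e, u} G →⋆ₙₐ[ℂ] (Lp ℂ 2 μ →L[ℂ] Lp ℂ 2 μ),
      B.IsInducedRep π) ∧
    (∃! P : Lp ℂ 1 μ →L[ℂ] Lp ℂ 1 μ, IsPerronFrobenius F P) ∧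
    ∀ (π : Ultragraph.CStarAlg.{v, e, u} G →⋆ₙₐ[ℂ] (Lp ℂ 2 μ →L[ℂ] Lp ℂ 2 μ))
      (P : Lp ℂ 1 μ →L[ℂ] Lp ℂ 1 μ), B.IsInducedRep π → IsPerronFrobenius F P →
      -- finitely many distinct edges
      (∀ (φ : Lp ℂ 2 μ) (n : ℕ) (ed : Fin n → E), Function.Injective ed →
        Function.support φ ≤ᵐ[μ] (⋃ i, B.R (ed i) : Set X) →
        P (sqL1 φ) =ᵐ[μ] fun x => ∑ i, (π (star (G.genS (ed i))) φ x) ^ 2) ∧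
      -- a sequence of distinct edges
      (∀ (φ : Lp ℂ 2 μ) (ed : ℕ → E), Function.Injective ed →
        Function.support φ ≤ᵐ[μ] (⋃ i, B.R (ed i) : Set X) →
        Tendsto (fun n => ∑ i ∈ Finset.range n, sqL1 (π (star (G.genS (ed i))) φ)) atTop
          (𝓝 (P (sqL1 φ)))) ∧
      -- general integrable functions, a sequence of distinct edges
      (∀ (η : Lp ℂ 1 μ) (η₁ η₂ η₃ η₄ : Lp ℝ 1 μ) (ed : ℕ → E), Function.Injective ed →
        0 ≤ η₁ → 0 ≤ η₂ → 0 ≤ η₃ → 0 ≤ η₄ →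
        (η =ᵐ[μ] fun x => (η₁ x : ℂ) - η₂ x + Complex.I * ((η₃ x : ℂ) - η₄ x)) →
        Function.support η₁ ≤ᵐ[μ] (⋃ i, B.R (ed i) : Set X) →
        Function.support η₂ ≤ᵐ[μ] (⋃ i, B.R (ed i) : Set X) →
        Function.support η₃ ≤ᵐ[μ] (⋃ i, B.R (ed i) : Set X) →
        Function.support η₄ ≤ᵐ[μ] (⋃ i, B.R (ed i) : Set X) →
        Tendsto (fun n => ∑ i ∈ Finset.range n,
            (sqL1 (π (star (G.genS (ed i))) (sqrtL2 η₁))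
              - sqL1 (π (star (G.genS (ed i))) (sqrtL2 η₂))
              + Complex.I • sqL1 (π (star (G.genS (ed i))) (sqrtL2 η₃))
              - Complex.I • sqL1 (π (star (G.genS (ed i))) (sqrtL2 η₄)))) atTop
          (𝓝 (P η))) ∧
      -- general integrable functions, finitely many distinct edges
      (∀ (η : Lp ℂ 1 μ) (η₁ η₂ η₃ η₄ : Lp ℝ 1 μ) (n : ℕ) (ed : Fin n → E),
        Function.Injective ed →
        0 ≤ η₁ → 0 ≤ η₂ → 0 ≤ η₃ → 0 ≤ η₄ →
        (η =ᵐ[μ] fun x => (η₁ x : ℂ) - η₂ x + Complex.I * ((η₃ x : ℂ) - η₄ x)) →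
        Function.support η₁ ≤ᵐ[μ] (⋃ i, B.R (ed i) : Set X) →
        Function.support η₂ ≤ᵐ[μ] (⋃ i, B.R (ed i) : Set X) →
        Function.support η₃ ≤ᵐ[μ] (⋃ i, B.R (ed i) : Set X) →
        Function.support η₄ ≤ᵐ[μ] (⋃ i, B.R (ed i) : Set X) →
        P η = ∑ i,
            (sqL1 (π (star (G.genS (ed i))) (sqrtL2 η₁))
              - sqL1 (π (star (G.genS (ed i))) (sqrtL2 η₂))
              + Complex.I • sqL1 (π (star (G.genS (ed i))) (sqrtL2 η₃))
              - Complex.I • sqL1 (π (star (G.genS (ed i))) (sqrtL2 η₄)))) := by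
  refine ⟨B.existsUnique_isInducedRep, existsUnique_isPerronFrobenius hF, fun π P hπ hP => ?_⟩
  -- Each square `(π(s_e*) φ)²` becomes `P` of the square of a cut-off of `φ`; finite sums then move
  -- inside `P` by linearity and limits by continuity. Injectivity of `ed` serves to make the sets
  -- `R (ed i)` almost disjoint.
  have hkey := hπ.sqL1_star_genS hF.measurable hFB hP
  have hfin : ∀ (φ : Lp ℂ 2 μ) (n : ℕ) (ed : Fin n → E), Function.Injective ed →
      Function.support φ ≤ᵐ[μ] (⋃ i, B.R (ed i) : Set X) →
      ∑ i, sqL1 (π (star (G.genS (ed i))) φ) = P (sqL1 φ) := by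
    intro φ n ed hed hφ
    simp_rw [hkey]
    rw [← map_sum, sum_univ_sqL1_indicatorL (fun i => B.measurableSet_R (ed i))
      (fun i j hij => B.R_disjoint _ _ (hed.ne hij)) hφ]
  have hlim : ∀ (φ : Lp ℂ 2 μ) (ed : ℕ → E), Function.Injective ed →
      Function.support φ ≤ᵐ[μ] (⋃ i, B.R (ed i) : Set X) →
      Tendsto (fun n => ∑ i ∈ Finset.range n, sqL1 (π (star (G.genS (ed i))) φ)) atTop
        (𝓝 (P (sqL1 φ))) := by
    intro φ ed hed hφ
    simp_rw [hkey, ← map_sum]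
    exact (P.continuous.tendsto _).comp
      (tendsto_sum_sqL1_indicatorL (fun i => B.measurableSet_R (ed i))
        (fun i j hij => B.R_disjoint _ _ (hed.ne hij)) hφ)
  refine ⟨fun φ n ed hed hφ => ?_, hlim, ?_, ?_⟩
  · rw [← hfin φ n ed hed hφ]
    filter_upwards [Lp.coeFn_finsetSum Finset.univ fun i => sqL1 (π (star (G.genS (ed i))) φ),
      ae_all_iff.2 fun i => coeFn_sqL1 (π (star (G.genS (ed i))) φ)] with x h1 h2
    rw [h1, Finset.sum_apply]
    exact Finset.sum_congr rfl fun i _ => h2 i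
  · intro η η₁ η₂ η₃ η₄ ed hed h₁ h₂ h₃ h₄ hη s₁ s₂ s₃ s₄
    have t₁ := hlim _ ed hed (support_sqrtL2_ae_le s₁)
    have t₂ := hlim _ ed hed (support_sqrtL2_ae_le s₂)
    have t₃ := hlim _ ed hed (support_sqrtL2_ae_le s₃)
    have t₄ := hlim _ ed hed (support_sqrtL2_ae_le s₄)
    rw [eq_sqL1_sqrtL2_combination h₁ h₂ h₃ h₄ hη]
    simp only [map_sub, map_add, map_smul, Finset.sum_sub_distrib, Finset.sum_add_distrib,
      ← Finset.smul_sum]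
    exact ((t₁.sub t₂).add (t₃.const_smul _)).sub (t₄.const_smul _)
  · intro η η₁ η₂ η₃ η₄ n ed hed h₁ h₂ h₃ h₄ hη s₁ s₂ s₃ s₄
    rw [eq_sqL1_sqrtL2_combination h₁ h₂ h₃ h₄ hη]
    simp only [map_sub, map_add, map_smul, Finset.sum_sub_distrib, Finset.sum_add_distrib,
      ← Finset.smul_sum]
    rw [hfin _ n ed hed (support_sqrtL2_ae_le s₁), hfin _ n ed hed (support_sqrtL2_ae_le s₂),
      hfin _ n ed hed (support_sqrtL2_ae_le s₃), hfin _ n ed hed (support_sqrtL2_ae_le s₄)]
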